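/- Let $d\in\mathbb N$, $T\ge 0$, let $\mathbb R^d$ carry the Euclidean norm $|\cdot|$, and let $\mathcal{CC}(\mathbb R^d)$ be the set of nonempty convex compact subsets of $\mathbb R^d$ with the Hausdorff metric. Let $f:[0,T]\times\mathbb R^d\to\mathbb R^d$ and $M:[0,T]\times\mathbb R^d\to\mathcal{CC}(\mathbb R^d)$ be continuous, and let $l_f:[0,T]\to\mathbb R$ and $L_M:[0,T]\to[0,\infty)$ be continuous and integrable such that, for all $t\in[0,T]$ and $x,x'\in\mathbb R^d$, $$\langle f(t,x)-f(t,x'),x-x'\rangle\le l_f(t)|x-x'|^2,\qquad \operatorname{dist}_H(M(t,x),M(t,x'))\le L_M(t)|x-x'|.$$ Let $$D:=\{(t,x,h): t\in[0,T],\ x\in\mathbb R^d,\ h\ge 0,\ t+h\le T,\ l_f(t+h)h<1\},$$ $$\Phi(t,x;h):=\{z\in\mathbb R^d: z\in x+hf(t+h,z)+hM(t,x)\}.$$ Then for every $(t,x,h)\in D$ the following holds. (i) For every $m\in M(t,x)$ the equation $z=x+hf(t+h,z)+hm$ has a unique solution $z=z(m)\in\mathbb R^d$, and $\Phi(t,x;h)=\bigcup_{m\in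 M(t,x)}\{z(m)\}$. (ii) The mapping $z:M(t,x)\to\mathbb R^d$ is Lipschitz with constant $\frac{h}{1-l_f(t+h)h}$. (iii) The set $\Phi(t,x;h)$ is path-connected (in particular nonempty). (iv) If $d=1$, then $\Phi(t,x;h)$ is a nonempty compact (convex) interval. -/

import Mathlib

open scoped Pointwise

/-- The space of nonempty, convex and compact subsets of `ℝ^d`, with the Hausdorff metric
(inherited from Mathlib's metric on nonempty compact sets). -/
abbrev CoCpSets (d : ℕ) : Type :=
  {K : TopologicalSpace.NonemptyCompacts (EuclideanSpace ℝ (Fin d)) //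
    Convex ℝ (K : Set (EuclideanSpace ℝ (Fin d)))}

/-- Elements of a convex compact set, as a subset of `ℝ^d`. -/
def CoCpSets.toSet {d : ℕ} (K : CoCpSets d) : Set (EuclideanSpace ℝ (Fin d)) :=
  (K.1 : Set (EuclideanSpace ℝ (Fin d)))

/-- The standing assumptions on the splitting `F(t,x) = f(t,x) + M(t,x)`. The functions
`f`, `M`, `lf`, `LM` matter only for times in `[0,T]`; their values at other times are
arbitrary. -/
structure SplittingAssumptions {d : ℕ} (T : ℝ)
    (f : ℝ → EuclideanSpace ℝ (Fin d) → EuclideanSpace ℝ (Fin d))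
    (M : ℝ → EuclideanSpace ℝ (Fin d) → CoCpSets d) (lf LM : ℝ → ℝ) : Prop where
  /-- `f` is jointly continuous on `[0,T] × ℝ^d`. -/
  f_cont : ContinuousOn (fun p : ℝ × EuclideanSpace ℝ (Fin d) => f p.1 p.2)
    (Set.Icc 0 T ×ˢ Set.univ)
  lf_cont : ContinuousOn lf (Set.Icc 0 T)
  lf_int : MeasureTheory.IntegrableOn lf (Set.Icc 0 T)
  /-- `f(t,·)` is one-sided Lipschitz with constant `lf t` (of any sign). -/
  f_osl : ∀ t ∈ Set.Icc 0 T, ∀ x x' : EuclideanSpace ℝ (Fin d),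
    inner ℝ (f t x - f t x') (x - x') ≤ lf t * ‖x - x'‖ ^ 2
  /-- `M` is jointly continuous on `[0,T] × ℝ^d` with respect to the Hausdorff metric. -/
  M_cont : ContinuousOn (fun p : ℝ × EuclideanSpace ℝ (Fin d) => M p.1 p.2)
    (Set.Icc 0 T ×ˢ Set.univ)
  LM_cont : ContinuousOn LM (Set.Icc 0 T)
  LM_int : MeasureTheory.IntegrableOn LM (Set.Icc 0 T)
  LM_nonneg : ∀ t ∈ Set.Icc 0 T, 0 ≤ LM t
  /-- `M(t,·)` is Lipschitz with constant `LM t` with respect to the Hausdorff metric. -/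
  M_lip : ∀ t ∈ Set.Icc 0 T, ∀ x x' : EuclideanSpace ℝ (Fin d),
    dist (M t x) (M t x') ≤ LM t * ‖x - x'‖

/-- The domain `D` of the scheme: `(t,x,h)` with `t ∈ [0,T]`, `h ≥ 0`, `lf(t+h) h < 1`.
The end time `t + h` has to lie in `[0,T]`, where `f(t+h,·)` and `lf(t+h)` are defined. -/
def schemeDomain (d : ℕ) (T : ℝ) (lf : ℝ → ℝ) : Set (ℝ × EuclideanSpace ℝ (Fin d) × ℝ) :=
  {p | p.1 ∈ Set.Icc 0 T ∧ 0 ≤ p.2.2 ∧ p.1 + p.2.2 ∈ Set.Icc 0 T ∧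
    lf (p.1 + p.2.2) * p.2.2 < 1}

/-- One step of the parameterized semi-implicit Euler scheme,
`Φ(t,x;h) = {z : z ∈ x + h f(t+h,z) + h M(t,x)}`. -/
def eulerStep {d : ℕ} (f : ℝ → EuclideanSpace ℝ (Fin d) → EuclideanSpace ℝ (Fin d))
    (M : ℝ → EuclideanSpace ℝ (Fin d) → CoCpSets d)
    (t : ℝ) (x : EuclideanSpace ℝ (Fin d)) (h : ℝ) : Set (EuclideanSpace ℝ (Fin d)) :=
  {z | z ∈ ({x + h • f (t + h) z} : Set (EuclideanSpace ℝ (Fin d))) + h • (M t x).toSet}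

/-- If `A` is monotone on a finite weighted family of points, then the weighted pairing of `A`
with the deviations from the barycenter `z` is nonnegative. -/
theorem sum_mul_inner_sub_barycenter_nonneg {ι E : Type*} [Fintype ι] [NormedAddCommGroup E]
    [InnerProductSpace ℝ E] {a : ι → ℝ} (ha : ∀ i, 0 ≤ a i) (hpos : 0 < ∑ i, a i)
    {A w : ι → E} (hA : ∀ i j, 0 ≤ inner ℝ (A i - A j) (w i - w j)) {z : E}
    (hz : ∑ i, a i • (w i - z) = 0) :
    0 ≤ ∑ i, a i * inner ℝ (A i) (w i - z) := by
  have hdouble : (∑ j, a j) * ∑ i, a i * inner ℝ (A i) (w i - z)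
      = ∑ i, ∑ j, a i * a j * inner ℝ (A i) (w i - w j) := by
    rw [Finset.mul_sum]
    refine Finset.sum_congr rfl fun i _ => ?_
    have hi : ∑ j, a j * inner ℝ (A i) (w j - z) = 0 := by
      have := congrArg (fun v => inner ℝ (A i) v) hz
      simpa [inner_sum, inner_smul_right] using this
    have : ∑ j, a i * a j * inner ℝ (A i) (w i - w j)
        = ∑ j, (a j * (a i * inner ℝ (A i) (w i - z)) - a i * (a j * inner ℝ (A i) (w j - z))) := by
      refine Finset.sum_congr rfl fun j _ => ?_
      rw [show w i - w j = (w i - z) - (w j - z) by abel, inner_sub_right]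
      ring
    rw [this, Finset.sum_sub_distrib, ← Finset.mul_sum, hi, ← Finset.sum_mul]
    ring
  have hswap : ∑ i, ∑ j, a i * a j * inner ℝ (A i) (w i - w j)
      = ∑ i, ∑ j, a i * a j * inner ℝ (-A j) (w i - w j) := by
    rw [Finset.sum_comm]
    refine Finset.sum_congr rfl fun i _ => Finset.sum_congr rfl fun j _ => ?_
    rw [← neg_sub (w i) (w j), inner_neg_right, inner_neg_left]
    ring
  have hnonneg : 0 ≤ ∑ i, ∑ j, a i * a j * inner ℝ (A i) (w i - w j)
      + ∑ i, ∑ j, a i * a j * inner ℝ (-A j) (w i - w j) := by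
    simp_rw [← Finset.sum_add_distrib, ← mul_add, ← inner_add_left, ← sub_eq_add_neg]
    exact Finset.sum_nonneg fun i _ => Finset.sum_nonneg fun j _ =>
      mul_nonneg (mul_nonneg (ha i) (ha j)) (hA i j)
  rw [← hswap, ← hdouble] at hnonneg
  exact nonneg_of_mul_nonneg_right (by linarith) hpos

/-- A finite family of convex functions, every nonnegative nontrivial combination of which is
somewhere nonpositive, is simultaneously below any `ε > 0` at some point. -/
theorem exists_forall_lt_of_convexOn {ι E : Type*} [Fintype ι] [AddCommGroup E] [Module ℝ E]
    {φ : ι → E → ℝ} (hφ : ∀ i, ConvexOn ℝ Set.univ (φ i))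
    (hcomb : ∀ a : ι → ℝ, (∀ i, 0 ≤ a i) → 0 < ∑ i, a i → ∃ z, ∑ i, a i * φ i z ≤ 0)
    {ε : ℝ} (hε : 0 < ε) : ∃ z, ∀ i, φ i z < ε := by
  classical
  by_contra hcon
  set C : Set (ι → ℝ) := {u | ∃ z, ∀ i, φ i z - ε < u i} with hC
  have hconv : Convex ℝ C := by
    rintro u ⟨x, hx⟩ v ⟨y, hy⟩ p q hp hq hpq
    refine ⟨p • x + q • y, fun i => ?_⟩
    have h1 := (hφ i).2 (Set.mem_univ x) (Set.mem_univ y) hp hq hpq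
    have h2 : p * (φ i x - ε) + q * (φ i y - ε) < p * u i + q * v i := by
      rcases hp.lt_or_eq with hp' | rfl
      · exact add_lt_add_of_lt_of_le (mul_lt_mul_of_pos_left (hx i) hp')
          (mul_le_mul_of_nonneg_left (hy i).le hq)
      · obtain rfl : q = 1 := by linarith
        simpa using hy i
    have h3 : p * ε + q * ε = ε := by rw [← add_mul, hpq, one_mul]
    simp only [smul_eq_mul, Pi.add_apply, Pi.smul_apply] at h1 ⊢
    linarith
  have hopen : IsOpen C := by
    have : C = ⋃ z, ⋂ i, {u : ι → ℝ | φ i z - ε < u i} := by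
      ext u; simp [hC]
    rw [this]
    exact isOpen_iUnion fun z => isOpen_iInter_of_finite fun i =>
      isOpen_lt continuous_const (continuous_apply i)
  have h0 : (0 : ι → ℝ) ∉ C := fun ⟨z, hz⟩ => hcon ⟨z, fun i => by simpa using hz i⟩
  obtain ⟨f, hf⟩ := geometric_hahn_banach_open_point hconv hopen h0
  rw [map_zero] at hf
  have hfsum : ∀ u : ι → ℝ, f u = ∑ i, u i * f (Pi.single i 1) := fun u => by
    conv_lhs => rw [pi_eq_sum_univ' u]
    simp only [map_sum, map_smul, smul_eq_mul]
  have hmem : ∀ z, (fun i => φ i z - ε / 2) ∈ C := fun z => ⟨z, fun i => by linarith⟩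
  have hle : ∀ i, f (Pi.single i 1) ≤ 0 := by
    intro i
    by_contra! hi
    set u : ι → ℝ := fun i => φ i 0 - ε / 2 with hu
    have hk : 0 ≤ -f u / f (Pi.single i 1) :=
      div_nonneg (neg_nonneg.2 (hf u (hmem 0)).le) hi.le
    have := hf (u + (-f u / f (Pi.single i 1)) • Pi.single i 1) ⟨0, fun j => by
      have : 0 ≤ (Pi.single i 1 : ι → ℝ) j := by
        rw [Pi.single_apply]; split_ifs <;> norm_num
      have := mul_nonneg hk this
      simp only [hu, Pi.add_apply, Pi.smul_apply, smul_eq_mul]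
      linarith⟩
    rw [map_add, map_smul, smul_eq_mul, div_mul_cancel₀ _ hi.ne'] at this
    linarith
  have hsum0 : 0 ≤ ∑ i, -f (Pi.single i 1) := Finset.sum_nonneg fun i _ => neg_nonneg.2 (hle i)
  have hpos : 0 < ∑ i, -f (Pi.single i 1) := by
    refine hsum0.lt_of_ne fun h => ?_
    have hz := (Finset.sum_eq_zero_iff_of_nonneg fun i _ => neg_nonneg.2 (hle i)).1 h.symm
    have := hf _ (hmem 0)
    rw [hfsum, Finset.sum_eq_zero fun i hi => by rw [neg_eq_zero.1 (hz i hi), mul_zero]] at this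
    exact lt_irrefl _ this
  obtain ⟨z, hz⟩ := hcomb _ (fun i => neg_nonneg.2 (hle i)) hpos
  have := hf _ (hmem z)
  rw [hfsum] at this
  have hsplit : ∑ i, (φ i z - ε / 2) * f (Pi.single i 1)
      = -(∑ i, -f (Pi.single i 1) * φ i z) + ε / 2 * ∑ i, -f (Pi.single i 1) := by
    rw [Finset.mul_sum, ← Finset.sum_neg_distrib, ← Finset.sum_add_distrib]
    exact Finset.sum_congr rfl fun i _ => by ring
  have := mul_pos (half_pos hε) hpos
  linarith

/-- Approximate solution of the strong Minty variational inequality on a finite set of test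
points. -/
theorem exists_forall_mem_finset_minty_lt {E : Type*} [NormedAddCommGroup E]
    [InnerProductSpace ℝ E] {G : E → E} {c : ℝ} (hc : 0 < c)
    (hmono : ∀ x y, c * ‖x - y‖ ^ 2 ≤ inner ℝ (G x - G y) (x - y)) (s : Finset E)
    {ε : ℝ} (hε : 0 < ε) :
    ∃ z, ∀ w ∈ s, c * ‖w - z‖ ^ 2 - inner ℝ (G w) (w - z) < ε := by
  suffices ∃ z, ∀ w : s, c * ‖(w : E) - z‖ ^ 2 - inner ℝ (G w) (w - z) < ε from
    this.imp fun z hz w hw => hz ⟨w, hw⟩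
  refine exists_forall_lt_of_convexOn
    (φ := fun (w : s) z => c * ‖(w : E) - z‖ ^ 2 - inner ℝ (G w) (w - z)) ?_ ?_ hε
  · intro w
    refine ⟨convex_univ, fun x _ y _ p q hp hq hpq => ?_⟩
    have hsub : (w : E) - (p • x + q • y) = p • (w - x) + q • (w - y) := by
      obtain rfl : q = 1 - p := by linarith
      module
    simp only [hsub, smul_eq_mul, inner_add_right, inner_smul_right, ← real_inner_self_eq_norm_sq,
      inner_add_left, real_inner_smul_left]
    rw [real_inner_comm ((w : E) - x) ((w : E) - y)]
    have hsq : 0 ≤ inner ℝ (((w : E) - x) - (w - y)) (((w : E) - x) - (w - y)) :=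
      real_inner_self_nonneg
    rw [real_inner_sub_sub_self] at hsq
    obtain rfl : q = 1 - p := by linarith
    have := mul_nonneg (mul_nonneg hc.le (mul_nonneg hp hq)) hsq
    linarith
  · intro a ha hpos
    set z : E := (∑ i, a i)⁻¹ • ∑ i, a i • (i : E) with hzdef
    have hz : ∑ i, a i • ((i : E) - z) = 0 := by
      simp_rw [smul_sub]
      rw [Finset.sum_sub_distrib, ← Finset.sum_smul, hzdef, smul_inv_smul₀ hpos.ne', sub_self]
    have key := sum_mul_inner_sub_barycenter_nonneg ha hpos
      (A := fun i : s => G i - c • (i : E)) (w := fun i : s => (i : E)) (fun i j => by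
        have := hmono i j
        rw [show G i - c • (i : E) - (G j - c • (j : E)) = (G i - G j) - c • ((i : E) - j) by
          module, inner_sub_left, real_inner_smul_left, real_inner_self_eq_norm_sq]
        linarith) hz
    have hz' : ∑ i, a i * inner ℝ z ((i : E) - z) = 0 := by
      have := congrArg (fun v => inner ℝ z v) hz
      simpa only [inner_sum, inner_smul_right, inner_zero_right] using this
    refine ⟨z, ?_⟩
    have : ∑ i, a i * (c * ‖(i : E) - z‖ ^ 2 - inner ℝ (G i) (i - z))
        = -(∑ i, a i * inner ℝ (G i - c • (i : E)) (i - z))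
          - c * ∑ i, a i * inner ℝ z ((i : E) - z) := by
      rw [Finset.mul_sum, ← Finset.sum_neg_distrib, ← Finset.sum_sub_distrib]
      refine Finset.sum_congr rfl fun i _ => ?_
      rw [← real_inner_self_eq_norm_sq, inner_sub_left (G i), real_inner_smul_left,
        inner_sub_left (i : E) z]
      ring
    rw [this, hz', mul_zero, sub_zero]
    exact neg_nonpos.2 key

/-- A continuous strongly monotone map of a proper inner product space has a zero. -/
theorem exists_eq_zero_of_stronglyMonotone {E : Type*} [NormedAddCommGroup E]
    [InnerProductSpace ℝ E] [ProperSpace E] {G : E → E} (hG : Continuous G) {c : ℝ} (hc : 0 < c)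
    (hmono : ∀ x y, c * ‖x - y‖ ^ 2 ≤ inner ℝ (G x - G y) (x - y)) : ∃ z, G z = 0 := by
  set K : E × Set.Ioi (0 : ℝ) → Set E := fun p =>
    {z | c * ‖p.1 - z‖ ^ 2 - inner ℝ (G p.1) (p.1 - z) ≤ p.2} with hK
  have hclosed : ∀ p, IsClosed (K p) := fun p => isClosed_le (by fun_prop) continuous_const
  have hbdd : ∀ p, Bornology.IsBounded (K p) := by
    intro p
    refine (Metric.isBounded_closedBall (x := p.1)
      (r := (‖G p.1‖ + p.2) / c + 1)).subset fun z hz => ?_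
    have hz : c * ‖p.1 - z‖ ^ 2 - inner ℝ (G p.1) (p.1 - z) ≤ p.2 := hz
    have hp : (0 : ℝ) < p.2 := p.2.2
    have hi := real_inner_le_norm (G p.1) (p.1 - z)
    rw [mem_closedBall_iff_norm, norm_sub_rev]
    by_contra! hlt
    have hn : 0 ≤ (‖G p.1‖ + p.2) / c := by positivity
    have h1 : ‖G p.1‖ + p.2 < c * ‖p.1 - z‖ := by
      rw [← div_lt_iff₀' hc]; linarith
    have h2 : 1 < ‖p.1 - z‖ := by linarith
    nlinarith [mul_lt_mul_of_pos_right h1 (zero_lt_one.trans h2)]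
  have hcompact : ∀ p, IsCompact (K p) := fun p =>
    Metric.isCompact_of_isClosed_isBounded (hclosed p) (hbdd p)
  obtain ⟨z, hz⟩ : (⋂ p, K p).Nonempty := by
    have h := (hcompact (0, ⟨1, Set.mem_Ioi.2 one_pos⟩)).inter_iInter_nonempty K hclosed fun u => by
      classical
      obtain ⟨ε, hε, hle⟩ : ∃ ε : ℝ, 0 < ε ∧
          ∀ p ∈ insert ((0 : E), (⟨1, Set.mem_Ioi.2 one_pos⟩ : Set.Ioi (0 : ℝ))) u, ε ≤ p.2 := by
        refine ⟨(insert ((0 : E), (⟨1, Set.mem_Ioi.2 one_pos⟩ : Set.Ioi (0 : ℝ))) u).inf'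
          (Finset.insert_nonempty _ _) fun p => (p.2 : ℝ), ?_, fun p hp =>
            Finset.inf'_le (fun p : E × Set.Ioi (0 : ℝ) => (p.2 : ℝ)) hp⟩
        rw [Finset.lt_inf'_iff]
        exact fun p _ => p.2.2
      obtain ⟨z, hz⟩ := exists_forall_mem_finset_minty_lt hc hmono
        ((insert ((0 : E), (⟨1, Set.mem_Ioi.2 one_pos⟩ : Set.Ioi (0 : ℝ))) u).image Prod.fst) hε
      have hmem : ∀ p ∈ insert ((0 : E), (⟨1, Set.mem_Ioi.2 one_pos⟩ : Set.Ioi (0 : ℝ))) u, z ∈ K p :=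
        fun p hp => (hz p.1 (Finset.mem_image_of_mem _ hp)).le.trans (hle p hp)
      exact ⟨z, hmem _ (Finset.mem_insert_self _ _),
        Set.mem_iInter₂.2 fun p hp => hmem p (Finset.mem_insert_of_mem hp)⟩
    exact h.mono Set.inter_subset_right
  have hminty : ∀ w, 0 ≤ inner ℝ (G w) (w - z) := fun w => by
    have : c * ‖w - z‖ ^ 2 - inner ℝ (G w) (w - z) ≤ 0 :=
      le_of_forall_pos_le_add fun ε hε =>
        (Set.mem_iInter.1 hz (w, ⟨ε, hε⟩)).trans_eq (zero_add ε).symm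
    have : 0 ≤ c * ‖w - z‖ ^ 2 := by positivity
    linarith
  have hlim : Filter.Tendsto (fun t : ℝ => inner ℝ (G (z - t • G z)) (G z))
      (nhdsWithin 0 (Set.Ioi 0)) (nhds (inner ℝ (G z) (G z))) := by
    have : Continuous fun t : ℝ => inner ℝ (G (z - t • G z)) (G z) := by fun_prop
    simpa using (this.tendsto 0).mono_left nhdsWithin_le_nhds
  have hle : inner ℝ (G z) (G z) ≤ (0 : ℝ) := by
    refine le_of_tendsto hlim (Filter.eventually_of_mem self_mem_nhdsWithin fun t ht => ?_)
    have ht : (0 : ℝ) < t := ht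
    have := hminty (z - t • G z)
    rw [show z - t • G z - z = -(t • G z) by abel, inner_neg_right, inner_smul_right] at this
    exact nonpos_of_mul_nonpos_right (by linarith) ht
  exact ⟨z, real_inner_self_nonpos.1 hle⟩

/-- Two solutions of `z = y + h g(z)` with data `y`, `y'` differ by at most
`‖y - y'‖ / (1 - l h)` if `g` is one-sided Lipschitz with constant `l`. -/
theorem mul_norm_sub_le_of_implicit_eq {E : Type*} [NormedAddCommGroup E] [InnerProductSpace ℝ E]
    {g : E → E} {l h : ℝ} (hh : 0 ≤ h)
    (hg : ∀ x y, inner ℝ (g x - g y) (x - y) ≤ l * ‖x - y‖ ^ 2) {y y' z z' : E}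
    (hz : z = y + h • g z) (hz' : z' = y' + h • g z') :
    (1 - l * h) * ‖z - z'‖ ≤ ‖y - y'‖ := by
  have hsub : z - z' = (y - y') + h • (g z - g z') := by
    nth_rewrite 1 [hz, hz']
    module
  have h1 : ‖z - z'‖ ^ 2 ≤ ‖y - y'‖ * ‖z - z'‖ + h * (l * ‖z - z'‖ ^ 2) := by
    have : ‖z - z'‖ ^ 2 = inner ℝ (y - y') (z - z') + h * inner ℝ (g z - g z') (z - z') := by
      rw [← real_inner_smul_left, ← inner_add_left, ← hsub, real_inner_self_eq_norm_sq]
    exact this.trans_le <| add_le_add (real_inner_le_norm _ _) (mul_le_mul_of_nonneg_left (hg z z') hh)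
  rcases (norm_nonneg (z - z')).eq_or_lt with h0 | h0
  · rw [← h0, mul_zero]
    exact norm_nonneg _
  · refine le_of_mul_le_mul_right ?_ h0
    linarith

/-- Solvability of the implicit equation `z = y + h g(z)` for continuous one-sided Lipschitz
`g`. -/
theorem exists_implicit_eq {E : Type*} [NormedAddCommGroup E] [InnerProductSpace ℝ E]
    [ProperSpace E] {g : E → E} (hcont : Continuous g) {l h : ℝ} (hh : 0 ≤ h) (hlh : l * h < 1)
    (hg : ∀ x y, inner ℝ (g x - g y) (x - y) ≤ l * ‖x - y‖ ^ 2) (y : E) :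
    ∃ z, z = y + h • g z := by
  obtain ⟨z, hz⟩ := exists_eq_zero_of_stronglyMonotone (G := fun z => z - (y + h • g z))
    (by fun_prop) (sub_pos.2 hlh) fun u v => by
      have := mul_le_mul_of_nonneg_left (hg u v) hh
      rw [show u - (y + h • g u) - (v - (y + h • g v)) = (u - v) - h • (g u - g v) by module,
        inner_sub_left, real_inner_smul_left, real_inner_self_eq_norm_sq]
      linarith
  exact ⟨z, sub_eq_zero.1 hz⟩

/-- A compact connected set in one-dimensional Euclidean space is an interval. -/
theorem exists_eq_setOf_apply_mem_Icc {s : Set (EuclideanSpace ℝ (Fin 1))} (hs : IsConnected s)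
    (hs' : IsCompact s) (i : Fin 1) : ∃ a b : ℝ, a ≤ b ∧ s = {z | z i ∈ Set.Icc a b} := by
  have hc : Continuous fun z : EuclideanSpace ℝ (Fin 1) => z i := by fun_prop
  have hI := eq_Icc_of_connected_compact (hs.image _ hc.continuousOn) (hs'.image hc)
  set a := sInf ((fun z : EuclideanSpace ℝ (Fin 1) => z i) '' s)
  set b := sSup ((fun z : EuclideanSpace ℝ (Fin 1) => z i) '' s)
  refine ⟨a, b, Set.nonempty_Icc.1 (hI ▸ hs.nonempty.image _), ?_⟩
  ext z
  rw [Set.mem_ofPred_eq, ← hI]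
  refine ⟨fun hz => ⟨z, hz, rfl⟩, ?_⟩
  rintro ⟨w, hw, hwz⟩
  have : w = z := by
    ext j
    rw [Subsingleton.elim j i]
    exact hwz
  exact this ▸ hw

theorem lemma9 {d : ℕ} {T : ℝ}
    {f : ℝ → EuclideanSpace ℝ (Fin d) → EuclideanSpace ℝ (Fin d)}
    {M : ℝ → EuclideanSpace ℝ (Fin d) → CoCpSets d} {lf LM : ℝ → ℝ}
    (hA : SplittingAssumptions T f M lf LM)
    (t : ℝ) (x : EuclideanSpace ℝ (Fin d)) (h : ℝ) (hD : (t, x, h) ∈ schemeDomain d T lf) :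
    (∃ z : (M t x).toSet → EuclideanSpace ℝ (Fin d),
      (∀ m : (M t x).toSet,
        z m = x + h • f (t + h) (z m) + h • (m : EuclideanSpace ℝ (Fin d)) ∧
        ∀ w : EuclideanSpace ℝ (Fin d),
          w = x + h • f (t + h) w + h • (m : EuclideanSpace ℝ (Fin d)) → w = z m) ∧
      eulerStep f M t x h = (⋃ m : (M t x).toSet, {z m}) ∧
      ∀ m m' : (M t x).toSet,
        ‖z m - z m'‖ ≤ h / (1 - lf (t + h) * h) *
          ‖(m : EuclideanSpace ℝ (Fin d)) - (m' : EuclideanSpace ℝ (Fin d))‖) ∧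
    IsPathConnected (eulerStep f M t x h) ∧
    (d = 1 → ∀ i : Fin d, ∃ a b : ℝ, a ≤ b ∧ eulerStep f M t x h = {z | z i ∈ Set.Icc a b}) := by
  obtain ⟨-, hh, hth, hlh⟩ := hD
  change 0 ≤ h at hh
  change t + h ∈ Set.Icc 0 T at hth
  change lf (t + h) * h < 1 at hlh
  have hosl := hA.f_osl (t + h) hth
  have hcont : Continuous (f (t + h)) :=
    hA.f_cont.comp_continuous (f := fun z => (t + h, z)) (by fun_prop) fun z => ⟨hth, trivial⟩
  have hpos : 0 < 1 - lf (t + h) * h := sub_pos.2 hlh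
  choose z hz using fun m : (M t x).toSet =>
    exists_implicit_eq hcont hh hlh hosl (x + h • (m : EuclideanSpace ℝ (Fin d)))
  have huniq : ∀ (m : (M t x).toSet) (w : EuclideanSpace ℝ (Fin d)),
      w = x + h • f (t + h) w + h • (m : EuclideanSpace ℝ (Fin d)) → w = z m := by
    intro m w hw
    rw [add_right_comm] at hw
    have := mul_norm_sub_le_of_implicit_eq hh hosl hw (hz m)
    rw [sub_self, norm_zero] at this
    exact sub_eq_zero.1 (norm_le_zero_iff.1 (nonpos_of_mul_nonpos_right this hpos))
  have hzeq : ∀ m : (M t x).toSet,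
      z m = x + h • f (t + h) (z m) + h • (m : EuclideanSpace ℝ (Fin d)) := fun m => by
    rw [add_right_comm]
    exact hz m
  have hlip : ∀ m m' : (M t x).toSet,
      ‖z m - z m'‖ ≤ h / (1 - lf (t + h) * h) *
        ‖(m : EuclideanSpace ℝ (Fin d)) - (m' : EuclideanSpace ℝ (Fin d))‖ := by
    intro m m'
    have := mul_norm_sub_le_of_implicit_eq hh hosl (hz m) (hz m')
    rw [add_sub_add_left_eq_sub, ← smul_sub, norm_smul, Real.norm_of_nonneg hh] at this
    rw [div_mul_eq_mul_div, le_div_iff₀' hpos]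
    exact this
  have hrange : eulerStep f M t x h = Set.range z := by
    ext w
    simp only [eulerStep, Set.singleton_add, Set.mem_ofPred_eq, Set.mem_image, Set.mem_smul_set,
      Set.mem_range]
    constructor
    · rintro ⟨_, ⟨m, hm, rfl⟩, hw⟩
      exact ⟨⟨m, hm⟩, (huniq ⟨m, hm⟩ w hw.symm).symm⟩
    · rintro ⟨m, rfl⟩
      exact ⟨_, ⟨m, m.2, rfl⟩, (hzeq m).symm⟩
  have hzcont : Continuous z :=
    (LipschitzWith.of_dist_le' fun m m' => by
      rw [dist_eq_norm, Subtype.dist_eq, dist_eq_norm]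
      exact hlip m m').continuous
  have hMpath : PathConnectedSpace (M t x).toSet :=
    isPathConnected_iff_pathConnectedSpace.1
      ((M t x).2.isPathConnected (M t x).1.nonempty)
  have hMcompact : CompactSpace (M t x).toSet :=
    isCompact_iff_compactSpace.1 (M t x).1.isCompact
  have hpath : IsPathConnected (eulerStep f M t x h) := hrange ▸ isPathConnected_range hzcont
  refine ⟨⟨z, fun m => ⟨hzeq m, huniq m⟩, ?_, hlip⟩, hpath, ?_⟩
  · rw [hrange, Set.iUnion_singleton_eq_range]
  · rintro rfl i
    exact exists_eq_setOf_apply_mem_Icc hpath.isConnected (hrange ▸ isCompact_range hzcont) i
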